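/- Let $G$ be a group. For a set $A$, let $A^G$ be the set of maps $G\to A$, with the shift action $(gc)(h)=c(g^{-1}h)$. A map $\tau\colon A^G\to A^G$ is a cellular automaton if there are a finite set $M\subset G$ and a map $\mu\colon A^M\to A$ such that $\tau(c)(g)=\mu\big((g^{-1}c)|_M\big)$ for all $c\in A^G$, $g\in G$. If $A$ is a vector space over a field $k$, a cellular automaton $\tau\colon A^G\to A^G$ is linear if it is $k$-linear for the pointwise vector space structure on $A^G$. Two elements of $A^G$ are asymptotic if they agree outside a finite subset of $G$. The map $\tau$ is pre-injective if $x=y$ whenever $x,y\in A^G$ are asymptotic and $\tau(x)=\tau(y)$; it is post-surjective if for all $x,y\in A^G$ with $y$ asymptotic to $\tau(x)$ there is $z\in A^G$ asymptotic to $x$ with $\tau(z)=y$. A ring $R$ is stably finite if every one-sided invertible square matrix over $R$ is two-sided invertible. Then the following are equivalent: (i) $G$ is $L$-surjunctive: for every field $k$ and every finite-dimensional $k$-vector space $V$, every injective linear cellular automaton $V^G\to V^G$ is surjective; (ii) $G$ is linearly surjunctive: for every finite field $k$ and every finite-dimensional $k$-vector space $A$, every injective linear cellular automaton $A^G\to A^G$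 is surjective; (iii) $G$ is linearly dual surjunctive: for every finite field $k$ and every finite-dimensional $k$-vector space $A$, every post-surjective linear cellular automaton $A^G\to A^G$ is pre-injective; (iv) for every field $k$, the group ring $k[G]$ is stably finite. -/

import Mathlib

universe u v

namespace SymbolicDynamics

/-- The Bernoulli shift of `G` on configurations: `(g c)(h) = c (g⁻¹ h)`. -/
def shift {G : Type u} [Group G] {A : Type v} (g : G) (c : G → A) : G → A :=
  fun h => c (g⁻¹ * h)

/-- A map `τ : A^G → A^G` is a cellular automaton if it admits a finite memory set `M ⊆ G` and a
local defining map `μ : A^M → A` with `τ(c)(g) = μ((g⁻¹ c)|_M)`. -/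
def IsCellularAutomaton {G : Type u} [Group G] {A : Type v} (τ : (G → A) → (G → A)) : Prop :=
  ∃ (M : Finset G) (μ : (M → A) → A),
    ∀ (c : G → A) (g : G), τ c g = μ (fun m : M => shift g⁻¹ c (m : G))

/-- Two configurations are asymptotic if they agree outside a finite subset of `G`. -/
def Asymptotic {G : Type u} {A : Type v} (x y : G → A) : Prop :=
  ∃ E : Finset G, ∀ g : G, g ∉ E → x g = y g

/-- `τ` is pre-injective if asymptotic configurations with the same image are equal. -/
def PreInjective {G : Type u} {A : Type v} (τ : (G → A) → (G → A)) : Prop :=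
  ∀ x y : G → A, Asymptotic x y → τ x = τ y → x = y

/-- `τ` is post-surjective if, whenever `y` is asymptotic to `τ x`, there is `z` asymptotic to `x`
with `τ z = y`. -/
def PostSurjective {G : Type u} {A : Type v} (τ : (G → A) → (G → A)) : Prop :=
  ∀ x y : G → A, Asymptotic y (τ x) → ∃ z : G → A, Asymptotic z x ∧ τ z = y

/-- `G` is `L`-surjunctive: over every field, every injective linear cellular automaton with
finite-dimensional alphabet is surjective. -/
def IsLSurjunctive (G : Type u) [Group G] : Prop :=
  ∀ (k : Type v) [Field k] (V : Type v) [AddCommGroup V] [Module k V] [FiniteDimensional k V]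
    (τ : (G → V) →ₗ[k] (G → V)),
    IsCellularAutomaton τ → Function.Injective τ → Function.Surjective τ

/-- `G` is linearly surjunctive: over every finite field, every injective linear cellular automaton
with finite-dimensional alphabet is surjective. -/
def IsLinearlySurjunctive (G : Type u) [Group G] : Prop :=
  ∀ (k : Type v) [Field k] [Finite k] (A : Type v) [AddCommGroup A] [Module k A]
    [FiniteDimensional k A] (τ : (G → A) →ₗ[k] (G → A)),
    IsCellularAutomaton τ → Function.Injective τ → Function.Surjective τ

/-- `G` is linearly dual surjunctive: over every finite field, every post-surjective linear
cellular automaton with finite-dimensional alphabet is pre-injective. -/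
def IsLinearlyDualSurjunctive (G : Type u) [Group G] : Prop :=
  ∀ (k : Type v) [Field k] [Finite k] (A : Type v) [AddCommGroup A] [Module k A]
    [FiniteDimensional k A] (τ : (G → A) →ₗ[k] (G → A)),
    IsCellularAutomaton τ → PostSurjective τ → PreInjective τ

end SymbolicDynamics

/-! In a basis of the alphabet a linear cellular automaton is a square matrix `A` over `k[G]`. On
finitely supported configurations it acts as `A.mulVec`, so pre-injectivity and post-surjectivity
are injectivity and surjectivity of `A.mulVec`. The space of all configurations is the dual of
`k[G]^ι`, where the automaton is the transpose of `A.vecMulLinear`; duality exchanges injectivity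
and surjectivity. Over a fixed field, both forms of surjunctivity thus say that one-sided inverses
of matrices are two-sided.

Finite fields suffice (`isStablyFiniteRing_of_finite_fields`): if `A * B = 1`, all coefficients lie
in a finitely generated domain `R`. Its residue fields at maximal ideals are finite, so the
coefficients of `B * A - 1` lie in every maximal ideal; as `R` is a Jacobson domain, they vanish. -/

namespace SymbolicDynamics

/-! ### Matrices over the group ring as cellular automata, and duality. -/

section MatrixCA

variable {k : Type*} [Field k] {G : Type*} [Group G] {ι : Type*}

/-- The linear cellular automaton on `(k^ι)^G` attached to a square matrix over `k[G]`. -/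
noncomputable def matrixCA [Fintype ι] (A : Matrix ι ι (MonoidAlgebra k G)) :
    (G → ι → k) →ₗ[k] (G → ι → k) where
  toFun c g i := ∑ j, (A i j).coeff.sum fun m r => r * c (g * m) j
  map_add' c d := by
    ext g i
    simp [mul_add, Finsupp.sum_add, Finset.sum_add_distrib]
  map_smul' a c := by
    ext g i
    simp [Finset.mul_sum, Finsupp.mul_sum, mul_left_comm]

lemma matrixCA_apply [Fintype ι] (A : Matrix ι ι (MonoidAlgebra k G)) (c : G → ι → k) (g : G) (i : ι) :
    matrixCA A c g i = ∑ j, (A i j).coeff.sum fun m r => r * c (g * m) j := rfl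

lemma isCellularAutomaton_matrixCA [Fintype ι] (A : Matrix ι ι (MonoidAlgebra k G)) :
    IsCellularAutomaton (matrixCA A) := by
  classical
  let M : Finset G := Finset.univ.biUnion fun i => Finset.univ.biUnion fun j => (A i j).coeff.support
  have hM (i j : ι) (m : G) (hm : m ∈ (A i j).coeff.support) : m ∈ M := by
    simp only [M, Finset.mem_biUnion]
    exact ⟨i, Finset.mem_univ _, j, Finset.mem_univ _, hm⟩
  refine ⟨M, fun p i => ∑ j, (A i j).coeff.sum fun m r =>
    r * if h : m ∈ M then p ⟨m, h⟩ j else 0, fun c g => ?_⟩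
  ext i
  rw [matrixCA_apply]
  refine Finset.sum_congr rfl fun j _ => Finsupp.sum_congr fun m hm => ?_
  simp [hM i j m hm, shift]

/-- The configuration of finite support attached to a vector over `k[G]`. -/
def configOfVec (x : ι → MonoidAlgebra k G) : G → ι → k := fun g i => (x i).coeff g⁻¹

lemma configOfVec_injective :
    Function.Injective (configOfVec : (ι → MonoidAlgebra k G) → G → ι → k) := by
  intro x y h
  funext i
  ext g
  simpa [configOfVec] using congrFun (congrFun h g⁻¹) i

lemma exists_configOfVec_eq {c : G → ι → k} (hc : Asymptotic c 0) :
    ∃ x : ι → MonoidAlgebra k G, configOfVec x = c := by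
  classical
  obtain ⟨E, hE⟩ := hc
  refine ⟨fun i => .ofCoeff (Finsupp.onFinset (E.image (·⁻¹)) (fun g => c g⁻¹ i) fun g hg => ?_), ?_⟩
  · by_contra h
    refine hg ?_
    rw [hE g⁻¹ fun h' => h (Finset.mem_image.2 ⟨_, h', inv_inv g⟩)]
    rfl
  · ext g i
    simp [configOfVec]

lemma asymptotic_configOfVec [Fintype ι] (x : ι → MonoidAlgebra k G) : Asymptotic (configOfVec x) 0 := by
  classical
  refine ⟨Finset.univ.biUnion fun i => (x i).coeff.support.image (·⁻¹), fun g hg => ?_⟩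
  ext i
  by_contra h
  refine hg (Finset.mem_biUnion.2 ⟨i, Finset.mem_univ _, Finset.mem_image.2 ⟨g⁻¹, ?_, inv_inv g⟩⟩)
  exact Finsupp.mem_support_iff.2 h

/-- The inversion in `configOfVec` turns `c (g * m)` into the coefficient at `m⁻¹ * g⁻¹`, as in a
convolution product. -/
lemma matrixCA_configOfVec [Fintype ι] (A : Matrix ι ι (MonoidAlgebra k G)) (x : ι → MonoidAlgebra k G) :
    matrixCA A (configOfVec x) = configOfVec (A.mulVec x) := by
  ext g i
  simp [matrixCA_apply, configOfVec, Matrix.mulVec, dotProduct, MonoidAlgebra.coeff_sum,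
    Finsupp.finsetSum_apply, MonoidAlgebra.coeff_mul_apply_left]

lemma asymptotic_iff_sub {k G ι : Type*} [Field k] {x y : G → ι → k} : Asymptotic x y ↔ Asymptotic (x - y) 0 := by
  simp [Asymptotic, sub_eq_zero]

lemma preInjective_matrixCA_iff [Fintype ι] (A : Matrix ι ι (MonoidAlgebra k G)) :
    PreInjective (matrixCA A) ↔ Function.Injective A.mulVec := by
  constructor
  · intro h x y hxy
    refine configOfVec_injective (h _ _ ?_ ?_)
    · obtain ⟨E, hE⟩ := asymptotic_configOfVec (x - y)
      refine ⟨E, fun g hg => ?_⟩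
      have := hE g hg
      ext i
      have := congrFun this i
      simpa [configOfVec, sub_eq_zero] using this
    · rw [matrixCA_configOfVec, matrixCA_configOfVec, hxy]
  · intro h x y hxy he
    obtain ⟨z, hz⟩ := exists_configOfVec_eq (asymptotic_iff_sub.1 hxy)
    have h0 : configOfVec (A.mulVec z) = configOfVec (A.mulVec 0) := by
      rw [← matrixCA_configOfVec, hz, map_sub, he, sub_self, Matrix.mulVec_zero]
      rfl
    have hz0 := h (configOfVec_injective h0)
    rw [← sub_eq_zero, ← hz, hz0]
    rfl

lemma postSurjective_matrixCA_iff [Fintype ι] (A : Matrix ι ι (MonoidAlgebra k G)) :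
    PostSurjective (matrixCA A) ↔ Function.Surjective A.mulVec := by
  constructor
  · intro h y
    obtain ⟨z, hz, hzy⟩ := h 0 (configOfVec y) (by simpa using asymptotic_configOfVec y)
    obtain ⟨x, rfl⟩ := exists_configOfVec_eq hz
    rw [matrixCA_configOfVec] at hzy
    exact ⟨x, configOfVec_injective hzy⟩
  · intro h x y hxy
    obtain ⟨w, hw⟩ := exists_configOfVec_eq (asymptotic_iff_sub.1 hxy)
    obtain ⟨v, rfl⟩ := h w
    refine ⟨x + configOfVec v, ?_, ?_⟩
    · rw [asymptotic_iff_sub, add_sub_cancel_left]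
      exact asymptotic_configOfVec v
    · rw [map_add, matrixCA_configOfVec, hw, add_sub_cancel]

/-- The pairing identifying configurations with linear forms on `k[G]^ι`. -/
noncomputable def configPairing {k G ι : Type*} [Field k] [Fintype ι] :
    (G → ι → k) →ₗ[k] Module.Dual k (ι → MonoidAlgebra k G) where
  toFun c :=
    { toFun := fun w => ∑ i, (w i).coeff.sum fun g r => r * c g i
      map_add' := fun v w => by
        rw [← Finset.sum_add_distrib]
        refine Finset.sum_congr rfl fun i _ => ?_
        simp only [Pi.add_apply, MonoidAlgebra.coeff_add]
        exact Finsupp.sum_add_index' (by simp) fun _ _ _ => add_mul _ _ _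
      map_smul' := fun a w => by
        simp only [Pi.smul_apply, MonoidAlgebra.coeff_smul, RingHom.id_apply, smul_eq_mul,
          Finset.mul_sum]
        refine Finset.sum_congr rfl fun i _ => ?_
        rw [Finsupp.sum_smul_index (by simp), Finsupp.mul_sum]
        simp [mul_assoc] }
  map_add' c d := by
    ext w
    simp [mul_add, Finsupp.sum_add, Finset.sum_add_distrib]
  map_smul' a c := by
    ext w
    simp [Finset.mul_sum, Finsupp.mul_sum, mul_left_comm]

lemma configPairing_apply {k G ι : Type*} [Field k] [Fintype ι] (c : G → ι → k) (w : ι → MonoidAlgebra k G) :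
    configPairing c w = ∑ i, (w i).coeff.sum fun g r => r * c g i := rfl

lemma configPairing_single [Fintype ι] [DecidableEq ι] (c : G → ι → k) (g : G) (i : ι) :
    configPairing c (Pi.single i (MonoidAlgebra.single g 1)) = c g i := by
  rw [configPairing_apply, Finset.sum_eq_single i]
  · simp
  · intro j _ hj
    simp [hj]
  · simp

lemma dual_ext_single [Fintype ι] [DecidableEq ι] {φ ψ : Module.Dual k (ι → MonoidAlgebra k G)}
    (h : ∀ g i, φ (Pi.single i (MonoidAlgebra.single g 1)) =
      ψ (Pi.single i (MonoidAlgebra.single g 1))) : φ = ψ := by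
  refine LinearMap.pi_ext' fun i => MonoidAlgebra.lhom_ext' fun g => LinearMap.ext_ring ?_
  exact h g i

/-- The vectors with a single entry `g` form a `k`-basis of `k[G]^ι`, so a linear form is an
arbitrary family of values on them. -/
lemma configPairing_bijective [Fintype ι] :
    Function.Bijective (configPairing : (G → ι → k) →ₗ[k] _) := by
  classical
  constructor
  · intro c d h
    ext g i
    rw [← configPairing_single c, h, configPairing_single]
  · intro φ
    refine ⟨fun g i => φ (Pi.single i (MonoidAlgebra.single g 1)), dual_ext_single fun g i => ?_⟩
    rw [configPairing_single]

lemma configPairing_matrixCA [Fintype ι] (A : Matrix ι ι (MonoidAlgebra k G)) (c : G → ι → k) :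
    configPairing (matrixCA A c) =
      (A.vecMulLinear.restrictScalars k).dualMap (configPairing c) := by
  classical
  refine dual_ext_single fun g i => ?_
  rw [configPairing_single, matrixCA_apply, LinearMap.dualMap_apply, configPairing_apply]
  refine Finset.sum_congr rfl fun j _ => ?_
  simp only [LinearMap.coe_restrictScalars, Matrix.vecMulLinear_apply, Matrix.single_vecMul]
  change _ = (MonoidAlgebra.coeff (MonoidAlgebra.single g 1 * A i j)).sum _
  have key (x : MonoidAlgebra k G) : x.coeff.sum (fun m r => r * c (g * m) j) =
      (MonoidAlgebra.coeff (MonoidAlgebra.single g 1 * x)).sum fun h r => r * c h j := by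
    induction x using MonoidAlgebra.induction_linear with
    | zero => simp
    | add x y hx hy =>
      rw [mul_add, MonoidAlgebra.coeff_add, MonoidAlgebra.coeff_add,
        Finsupp.sum_add_index' (by simp) (by simp [add_mul]),
        Finsupp.sum_add_index' (by simp) (by simp [add_mul]), hx, hy]
    | single m r => simp [MonoidAlgebra.single_mul_single]
  exact key _

/-- Over a field, a linear map is surjective exactly when its transpose is injective. -/
lemma injective_matrixCA_iff [Fintype ι] (A : Matrix ι ι (MonoidAlgebra k G)) :
    Function.Injective (matrixCA A) ↔ Function.Surjective A.vecMulLinear := by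
  have h : ⇑configPairing ∘ matrixCA A =
      (A.vecMulLinear.restrictScalars k).dualMap ∘ configPairing :=
    funext (configPairing_matrixCA A)
  rw [← configPairing_bijective.injective.of_comp_iff, h,
    Function.Injective.of_comp_iff' _ configPairing_bijective, LinearMap.dualMap_injective_iff]
  rfl

lemma surjective_matrixCA_iff [Fintype ι] (A : Matrix ι ι (MonoidAlgebra k G)) :
    Function.Surjective (matrixCA A) ↔ Function.Injective A.vecMulLinear := by
  have h : ⇑configPairing ∘ matrixCA A =
      (A.vecMulLinear.restrictScalars k).dualMap ∘ configPairing :=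
    funext (configPairing_matrixCA A)
  rw [← Function.Surjective.of_comp_iff' configPairing_bijective, h,
    configPairing_bijective.surjective.of_comp_iff, LinearMap.dualMap_surjective_iff]
  rfl

end MatrixCA

/-! ### From linear cellular automata to matrices. -/

section Representation

variable {k : Type*} [Field k] {G : Type*} [Group G] {V : Type*} [AddCommGroup V] [Module k V]

/-- In a basis of the alphabet, every linear cellular automaton is given by a matrix over `k[G]`. -/
lemma exists_matrixCA_eq {ι : Type*} [Fintype ι] (b : Module.Basis ι k V)
    (τ : (G → V) →ₗ[k] (G → V)) (hτ : IsCellularAutomaton τ) :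
    ∃ A : Matrix ι ι (MonoidAlgebra k G), ∀ c : G → V,
      (fun g => b.equivFun (τ c g)) = matrixCA A (fun g => b.equivFun (c g)) := by
  classical
  obtain ⟨M, μ, hμ⟩ := hτ
  -- The coefficient at `m` is the response at `1` to the basis vector `b j` placed at `m`.
  refine ⟨Matrix.of fun i j => ∑ m ∈ M, .single m (b.equivFun (τ (Pi.single m (b j)) 1) i), fun c => ?_⟩
  have hsum (x : G → k) (i j : ι) :
      (MonoidAlgebra.coeff (∑ m ∈ M, .single m (b.equivFun (τ (Pi.single m (b j)) 1) i) :
        MonoidAlgebra k G)).sum (fun m r => r * x m) =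
      ∑ m ∈ M, b.equivFun (τ (Pi.single m (b j)) 1) i * x m := by
    rw [MonoidAlgebra.coeff_sum,
      ← Finsupp.sum_finsetSum_index (by simp) (by simp [add_mul])]
    simp
  -- Locality replaces `c` by a finite sum of such impulses, to which linearity applies.
  have hloc (g : G) : τ c g = τ (∑ m ∈ M, ∑ j, b.equivFun (c (g * m)) j • Pi.single m (b j)) 1 := by
    rw [hμ, hμ]
    congr 1
    ext ⟨n, hn⟩
    simp only [shift, inv_inv, inv_one, one_mul, Finset.sum_apply, Pi.smul_apply, Pi.single_apply]
    rw [Finset.sum_eq_single_of_mem n hn]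
    · simp only [if_true]
      exact (b.sum_equivFun _).symm
    · intro m _ hm
      simp [Ne.symm hm]
  ext g i
  rw [matrixCA_apply, hloc]
  simp only [Matrix.of_apply, hsum (fun m => b.equivFun (c (g * m)) _), map_sum, map_smul, Finset.sum_apply, Pi.smul_apply, smul_eq_mul]
  rw [Finset.sum_comm]
  simp only [mul_comm]

end Representation

/-! ### Reduction from arbitrary fields to finite fields. -/

section FiniteFields

lemma isJacobsonRing_int : IsJacobsonRing ℤ := by
  refine isJacobsonRing_iff_prime_eq.2 fun P hP => ?_
  by_cases h : P = ⊥
  · subst h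
    refine le_antisymm (fun n hn => ?_) Ideal.le_jacobson
    by_contra h0
    -- A prime larger than `|n|` cannot divide `n ≠ 0`.
    obtain ⟨p, hp, hpp⟩ := Nat.exists_infinite_primes (n.natAbs + 1)
    have hpZ : Prime (p : ℤ) := Nat.prime_iff_prime_int.1 hpp
    have hmax : (Ideal.span {(p : ℤ)}).IsMaximal :=
      PrincipalIdealRing.isMaximal_of_irreducible hpZ.irreducible
    have hmem : n ∈ Ideal.span {(p : ℤ)} := Ideal.mem_sInf.1 hn ⟨bot_le, hmax⟩
    have hdvd := Int.natAbs_dvd_natAbs.2 (Ideal.mem_span_singleton.1 hmem)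
    have := Nat.le_of_dvd (Int.natAbs_pos.2 (by simpa using h0)) hdvd
    simp at this
    lia
  · have := hP.isMaximal h
    exact Ideal.jacobson_eq_self_of_isMaximal

/-- A field that is finitely generated as a ring is finite. -/
lemma finite_of_finiteType_int (K : Type*) [Field K] [alg : Algebra ℤ K]
    [Algebra.FiniteType ℤ K] : Finite K := by
  cases Subsingleton.elim alg (Ring.toIntAlgebra K)
  have := isJacobsonRing_int
  have hfin : Module.Finite ℤ K := finite_of_finite_type_of_isJacobsonRing ℤ K
  obtain ⟨p, hp⟩ := CharP.exists K
  rcases CharP.char_is_prime_or_zero K p with hpp | rfl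
  · have : Fact p.Prime := ⟨hpp⟩
    let := ZMod.algebra K p
    have : Module.Finite (ZMod p) K := Module.Finite.of_restrictScalars_finite ℤ (ZMod p) K
    exact Module.finite_of_finite (ZMod p)
  -- In characteristic zero, `ℤ` would embed in a field integral over it, hence be a field.
  · have := CharP.charP_to_charZero K
    exact absurd (isField_of_isIntegral_of_isField (FaithfulSMul.algebraMap_injective ℤ K)
      (Field.toIsField K)) Int.not_isField

lemma exists_map_subring_eq {k G : Type*} [Field k] {R : Type*} [CommRing R] (f : R →+* k)
    (hf : Function.Injective f) (x : MonoidAlgebra k G) (hx : ∀ g, x.coeff g ∈ f.range) :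
    ∃ y : MonoidAlgebra R G, ∀ g, f (y.coeff g) = x.coeff g := by
  choose y hy using hx
  refine ⟨.ofCoeff (Finsupp.onFinset x.coeff.support y fun g hg => ?_), fun g => hy g⟩
  rw [Finsupp.mem_support_iff, ← hy g]
  exact (map_ne_zero_iff f hf).2 hg

/-- Stable finiteness of group rings over all fields follows from that over finite fields. -/
lemma isStablyFiniteRing_of_finite_fields (G : Type u) [Group G]
    (h : ∀ (k : Type v) [Field k] [Finite k], IsStablyFiniteRing (MonoidAlgebra k G))
    (k : Type v) [Field k] : IsStablyFiniteRing (MonoidAlgebra k G) := by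
  refine ⟨fun n => ⟨fun {A B} hAB => ?_⟩⟩
  let S : Set k := (⋃ i, ⋃ j, Set.range (A i j).coeff) ∪ ⋃ i, ⋃ j, Set.range (B i j).coeff
  have hS : S.Finite := by
    refine .union ?_ ?_ <;>
    exact Set.finite_iUnion fun i => Set.finite_iUnion fun j => Finsupp.finite_range _
  let R := Algebra.adjoin ℤ S
  have hRft : Algebra.FiniteType ℤ R :=
    R.fg_iff_finiteType.1 (Subalgebra.fg_def.2 ⟨S, hS, rfl⟩)
  let f : R →+* k := R.val.toRingHom
  have hf : Function.Injective f := Subtype.val_injective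
  have hrange {x : k} (hx : x ∈ S) : x ∈ f.range := ⟨⟨x, Algebra.subset_adjoin hx⟩, rfl⟩
  have hA i j : ∃ y : MonoidAlgebra R G, ∀ g, f (y.coeff g) = (A i j).coeff g :=
    exists_map_subring_eq f hf _ fun g => hrange (.inl (by simp))
  have hB i j : ∃ y : MonoidAlgebra R G, ∀ g, f (y.coeff g) = (B i j).coeff g :=
    exists_map_subring_eq f hf _ fun g => hrange (.inr (by simp))
  choose A' hA' using hA
  choose B' hB' using hB
  let F := MonoidAlgebra.mapRingHom G f
  have hF : Function.Injective F := MonoidAlgebra.map_injective (f : R →+ k) hf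
  have hAF : (Matrix.of A').map F = A := by
    ext i j g
    simp [F, hA']
  have hBF : (Matrix.of B').map F = B := by
    ext i j g
    simp [F, hB']
  have hAB' : Matrix.of A' * Matrix.of B' = 1 := by
    refine Matrix.map_injective hF ?_
    change (Matrix.of A' * Matrix.of B').map F = Matrix.map 1 F
    rw [Matrix.map_mul, hAF, hBF, hAB, Matrix.map_one _ (map_zero F) (map_one F)]
  suffices hBA' : Matrix.of B' * Matrix.of A' = 1 by
    rw [← hAF, ← hBF, ← Matrix.map_mul, hBA', Matrix.map_one _ (map_zero F) (map_one F)]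
  have hjac : (⊥ : Ideal R).jacobson = ⊥ :=
    have := isJacobsonRing_int
    have : IsJacobsonRing R := isJacobsonRing_of_finiteType (A := ℤ)
    isJacobsonRing_iff_prime_eq.1 this _ Ideal.isPrime_bot
  rw [← sub_eq_zero]
  refine Matrix.ext fun i j => MonoidAlgebra.ext (Finsupp.ext fun g => ?_)
  rw [Matrix.zero_apply, MonoidAlgebra.coeff_zero, Finsupp.zero_apply, ← Ideal.mem_bot, ← hjac]
  refine Ideal.mem_sInf.2 fun {m} hm => ?_
  have hmax : m.IsMaximal := hm.2
  have hft : Algebra.FiniteType ℤ (R ⧸ m) :=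
    .of_surjective (Ideal.Quotient.mkₐ ℤ m) Ideal.Quotient.mk_surjective
  let : Field (R ⧸ m) := Ideal.Quotient.field m
  have : Finite (R ⧸ m) :=
    finite_of_finiteType_int (R ⧸ m) (alg := Ideal.Quotient.algebra ℤ)
  let Q := MonoidAlgebra.mapRingHom G (Ideal.Quotient.mk m)
  have hAQ : (Matrix.of A').map Q * (Matrix.of B').map Q = 1 := by
    rw [← Matrix.map_mul, hAB', Matrix.map_one _ (map_zero Q) (map_one Q)]
  have hBQ : (Matrix.of B').map Q * (Matrix.of A').map Q = 1 :=
    have := h (R ⧸ m)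
    mul_eq_one_symm hAQ
  have h0 : (Matrix.of B' * Matrix.of A' - 1).map Q = 0 := by
    rw [Matrix.map_sub _ (map_sub Q), Matrix.map_mul, hBQ,
      Matrix.map_one _ (map_zero Q) (map_one Q), sub_self]
  have hij : Q ((Matrix.of B' * Matrix.of A' - 1) i j) = 0 := congrFun (congrFun h0 i) j
  rw [← Ideal.Quotient.eq_zero_iff_mem, ← MonoidAlgebra.coeff_mapRingHom]
  exact congrArg (fun x => x.coeff g) hij

end FiniteFields

/-! ### Surjunctivity properties versus stable finiteness. -/

section Transport

variable {k : Type*} [Field k] {G : Type*} [Group G] {V : Type*} [AddCommGroup V] [Module k V]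

lemma surjective_of_injective_of_isStablyFiniteRing [FiniteDimensional k V]
    [IsStablyFiniteRing (MonoidAlgebra k G)] (τ : (G → V) →ₗ[k] (G → V))
    (hτ : IsCellularAutomaton τ) (hinj : Function.Injective τ) : Function.Surjective τ := by
  let b := Module.finBasis k V
  obtain ⟨A, hA⟩ := exists_matrixCA_eq b τ hτ
  let E : (G → V) ≃ (G → Fin _ → k) := Equiv.piCongrRight fun _ => b.equivFun.toEquiv
  have hE : E ∘ τ = matrixCA A ∘ E := funext hA
  rw [← E.injective.of_comp_iff, hE, E.injective_comp, injective_matrixCA_iff] at hinj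
  rw [← Function.Surjective.of_comp_iff' E.bijective, hE, E.surjective_comp, surjective_matrixCA_iff]
  exact Module.End.injective_of_surjective_fin hinj

lemma preInjective_of_postSurjective_of_isStablyFiniteRing [FiniteDimensional k V]
    [IsStablyFiniteRing (MonoidAlgebra k G)] (τ : (G → V) →ₗ[k] (G → V))
    (hτ : IsCellularAutomaton τ) (hpost : PostSurjective τ) : PreInjective τ := by
  classical
  let b := Module.finBasis k V
  obtain ⟨A, hA⟩ := exists_matrixCA_eq b τ hτ
  let E : (G → V) ≃ (G → Fin _ → k) := Equiv.piCongrRight fun _ => b.equivFun.toEquiv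
  have hE (c : G → V) : E (τ c) = matrixCA A (E c) := hA c
  have hasym (x y : G → V) : Asymptotic (E x) (E y) ↔ Asymptotic x y := by
    simp [Asymptotic, E]
  have hpost' : PostSurjective (matrixCA A) := by
    intro x y hxy
    obtain ⟨x, rfl⟩ := E.surjective x
    obtain ⟨y, rfl⟩ := E.surjective y
    rw [← hE, hasym] at hxy
    obtain ⟨z, hz, rfl⟩ := hpost x y hxy
    exact ⟨E z, (hasym _ _).2 hz, (hE z).symm⟩
  have hpre : PreInjective (matrixCA A) := by
    rw [postSurjective_matrixCA_iff] at hpost'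
    rw [preInjective_matrixCA_iff]
    obtain ⟨B, hB⟩ := Matrix.mulVec_surjective_iff_exists_right_inverse.1 hpost'
    refine Function.LeftInverse.injective (g := B.mulVec) fun x => ?_
    rw [Matrix.mulVec_mulVec, mul_eq_one_symm hB, Matrix.one_mulVec]
  intro x y hxy he
  exact E.injective (hpre _ _ ((hasym x y).2 hxy) (by rw [← hE, ← hE, he]))

lemma isStablyFiniteRing_of_surjective_of_injective
    (h : ∀ (n : ℕ) (τ : (G → Fin n → k) →ₗ[k] (G → Fin n → k)), IsCellularAutomaton τ →
      Function.Injective τ → Function.Surjective τ) : IsStablyFiniteRing (MonoidAlgebra k G) := by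
  refine ⟨fun n => ⟨fun {A B} hAB => ?_⟩⟩
  have hsurj : Function.Surjective B.vecMulLinear := fun x => ⟨Matrix.vecMul x A, by
    simp [Matrix.vecMul_vecMul, hAB]⟩
  have hinj := (surjective_matrixCA_iff B).1
    (h n _ (isCellularAutomaton_matrixCA B) ((injective_matrixCA_iff B).2 hsurj))
  -- Since `(B * A) * B = B`, the rows of `B * A` and `1` have the same image under `B`.
  refine Matrix.ext_of_single_vecMul fun i => hinj ?_
  rw [Matrix.vecMulLinear_apply, Matrix.vecMulLinear_apply, Matrix.vecMul_vecMul,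
    Matrix.vecMul_vecMul, mul_assoc, hAB, mul_one, one_mul]

lemma isStablyFiniteRing_of_preInjective_of_postSurjective
    (h : ∀ (n : ℕ) (τ : (G → Fin n → k) →ₗ[k] (G → Fin n → k)), IsCellularAutomaton τ →
      PostSurjective τ → PreInjective τ) : IsStablyFiniteRing (MonoidAlgebra k G) := by
  refine ⟨fun n => ⟨fun {A B} hAB => ?_⟩⟩
  have hsurj : Function.Surjective A.mulVec :=
    Matrix.mulVec_surjective_iff_exists_right_inverse.2 ⟨B, hAB⟩
  have hinj := (preInjective_matrixCA_iff A).1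
    (h n _ (isCellularAutomaton_matrixCA A) ((postSurjective_matrixCA_iff A).2 hsurj))
  -- The mirror argument on columns, from `A * (B * A) = A`.
  refine Matrix.ext_of_mulVec_single fun i => hinj ?_
  rw [Matrix.mulVec_mulVec, Matrix.mulVec_mulVec, ← mul_assoc, hAB, mul_one, one_mul]

end Transport

end SymbolicDynamics

theorem mainTheorem8 (G : Type u) [Group G] :
    List.TFAE
      [SymbolicDynamics.IsLSurjunctive.{u, v} G,
       SymbolicDynamics.IsLinearlySurjunctive.{u, v} G,
       SymbolicDynamics.IsLinearlyDualSurjunctive.{u, v} G,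
       ∀ (k : Type v) [Field k], IsStablyFiniteRing (MonoidAlgebra k G)] := by
  open SymbolicDynamics in
  tfae_have 1 → 2 := fun h k _ _ A _ _ _ τ => h k A τ
  tfae_have 2 → 4 := fun h => isStablyFiniteRing_of_finite_fields G fun k _ _ =>
    isStablyFiniteRing_of_surjective_of_injective fun n τ => h k (Fin n → k) τ
  tfae_have 3 → 4 := fun h => isStablyFiniteRing_of_finite_fields G fun k _ _ =>
    isStablyFiniteRing_of_preInjective_of_postSurjective fun n τ => h k (Fin n → k) τ
  tfae_have 4 → 1 := fun h k _ V _ _ _ τ =>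
    have := h k
    surjective_of_injective_of_isStablyFiniteRing τ
  tfae_have 4 → 3 := fun h k _ _ V _ _ _ τ =>
    have := h k
    preInjective_of_postSurjective_of_isStablyFiniteRing τ
  tfae_finish
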